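/- **Setting.** A finite limit theory $\mathbb T$ is given through its syntactic category $\mathcal C_{\mathbb T}$, a small category with finite limits; for a category $\mathcal E$, $\mathbb T[\mathcal E]$ is the category of finite-limit-preserving functors $\mathcal C_{\mathbb T}\to\mathcal E$ and natural transformations. Write $\mathcal B=\mathbb T[\mathrm{Set}]$, and $K_x=\mathcal C_{\mathbb T}(x,-)\in\mathcal B$, so that $x\mapsto K_x$ identifies $\mathcal C_{\mathbb T}^{op}$ with the finitely presentable objects of $\mathcal B$. A *saturated class* in $\mathcal B$ is a class $\mathcal V$ of maps between finitely presentable objects that is closed under composition, contains all isomorphisms between such objects, is right-cancellative ($l\in\mathcal V$, $fl\in\mathcal V$ imply $f\in\mathcal V$), is closed under pushout along maps to finitely presentable objects, and is closed under finite colimits in the category of arrows of $\mathcal B$. A *geometry* is a triple $(\mathbb T,\mathcal V,J)$ with $\mathcal V$ a saturated class in $\mathcal B$ and $J$ a Grothendieck topology on $\mathcal C_{\mathbb T}$ whose covers are generated by duals of maps in $\mathcal V$ (every $J$-covering sieve contains a $J$-covering family of arrows $y\to x$ whose dual $K_x\to K_y$ is in $\mathcal V$). For a Grothendieck topos $\mathcal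 E$, $\mathbb T_J[\mathcal E]\subseteq\mathbb T[\mathcal E]$ is the full subcategory of $J$-continuous models, i.e. those $M$ with $\coprod_i M(x_i)\to M(x)$ epimorphic for every $J$-covering family $(x_i\to x)_i$. For a geometric morphism $g:\mathcal F\to\mathcal E$, $g^*:\mathbb T[\mathcal E]\to\mathbb T[\mathcal F]$ and $g_*:\mathbb T[\mathcal F]\to\mathbb T[\mathcal E]$ are composition with the inverse and direct image. View $\mathcal V$ as a full subcategory of the category of arrows of $\mathcal B$. An arrow $u:M\to N$ of $\mathbb T[\mathcal E]$ is *local*, $u\in\mathrm{Loc}[\mathcal E]$, if its naturality square at each arrow of $\mathcal C_{\mathbb T}$ dual to a map in $\mathcal V$ is a pullback. It is *etale*, $u\in\mathrm{Et}[\mathcal E]$, if it corresponds to some object $P$ of $\mathrm{Lex}[\mathcal V^{op},\mathcal E]\simeq\mathrm{Geom}[\mathcal E,[\mathcal V,\mathrm{Set}]]$, which means: up to isomorphism, $M$ is $x\mapsto P(\mathrm{id}_{K_x})$, $N$ is the left Kan extension of $P$ along the codomain functor $\mathcal V^{op}\to\mathcal C_{\mathbb T}$, and $u$ is the unit of this Kan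 extension at the objects $\mathrm{id}_{K_x}$. Regard $\mathrm{Et}[\mathcal E]$ and $\mathrm{Loc}[\mathcal E]$ as full subcategories of the category of arrows of $\mathbb T[\mathcal E]$. **Statement.** Let $(\mathbb T,\mathcal V,J)$ be a geometry. 1. For every Grothendieck topos $\mathcal E$, $(\mathrm{Et}[\mathcal E],\mathrm{Loc}[\mathcal E])$ is an (orthogonal) factorization system on $\mathbb T[\mathcal E]$. 2. Let $g:\mathcal F\to\mathcal E$ be a geometric morphism of Grothendieck toposes. Then $g^*$ sends $\mathrm{Et}[\mathcal E]$ into $\mathrm{Et}[\mathcal F]$ and $\mathrm{Loc}[\mathcal E]$ into $\mathrm{Loc}[\mathcal F]$. The functor $g^*:\mathrm{Loc}[\mathcal E]\to\mathrm{Loc}[\mathcal F]$ has as right adjoint the restriction of $g_*$. The functor $g^*:\mathrm{Et}[\mathcal E]\to\mathrm{Et}[\mathcal F]$ has a right adjoint, which sends an etale arrow corresponding to $P\in\mathrm{Lex}[\mathcal V^{op},\mathcal F]$ to one corresponding to $g_*\circ P\in\mathrm{Lex}[\mathcal V^{op},\mathcal E]$. 3. For every Grothendieck topos $\mathcal E$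 and $u:F\to E$ in $\mathrm{Loc}[\mathcal E]$ with $E$ in $\mathbb T_J[\mathcal E]$, also $F$ is in $\mathbb T_J[\mathcal E]$. 4. Hence, for every Grothendieck topos $\mathcal E$ and every $f:F\to E$ in $\mathbb T[\mathcal E]$ with $E$ in $\mathbb T_J[\mathcal E]$, if $f=u_fn_f$ with $n_f:F\to H_f$ in $\mathrm{Et}[\mathcal E]$ and $u_f:H_f\to E$ in $\mathrm{Loc}[\mathcal E]$, then $H_f$ is in $\mathbb T_J[\mathcal E]$. 5. So $(\mathbb T,\mathbb T\to\mathbb T_J,\mathrm{Loc})$ is an admissibility structure: the classes $\mathrm{Loc}[\mathcal E]$ are preserved by inverse images along geometric morphisms (so that $\mathrm{Loc}$ is a sub-2-functor of $\mathcal E\mapsto\mathrm{Arrow}(\mathbb T[\mathcal E])$), each contains all isomorphisms and is left-cancellative ($v\in\mathrm{Loc}[\mathcal E]$, $vf\in\mathrm{Loc}[\mathcal E]$ imply $f\in\mathrm{Loc}[\mathcal E]$), and for every $\mathcal E$, every $f:F\to E$ in $\mathbb T[\mathcal E]$ with $E$ in $\mathbb T_J[\mathcal E]$ has a factorization $F\to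 H\xrightarrow{u}E$ with $H$ in $\mathbb T_J[\mathcal E]$ and $u\in\mathrm{Loc}[\mathcal E]$ which is initial among all factorizations of $f$ whose second arrow is in $\mathrm{Loc}[\mathcal E]$. -/

import Mathlib

open CategoryTheory CategoryTheory.Limits

universe u

/-- A Grothendieck topos: a category equivalent to the category of sheaves of (small) sets
on a small site. -/
class IsGrothendieckTopos (E : Type (u + 1)) [Category.{u} E] : Prop where
  exists_site : ∃ (D : Type u) (_ : SmallCategory D) (K : GrothendieckTopology D),
    Nonempty (E ≌ Sheaf K (Type u))

instance IsGrothendieckTopos.hasColimits (E : Type (u + 1)) [Category.{u} E]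
    [IsGrothendieckTopos E] : HasColimits E := by
  obtain ⟨D, _, K, ⟨e⟩⟩ := IsGrothendieckTopos.exists_site (E := E)
  have : HasColimits (Sheaf K (Type u)) := ⟨fun _ _ => by infer_instance⟩
  exact Adjunction.has_colimits_of_equivalence e.functor

/-- A geometric morphism `F ⟶ E`: an adjunction `inverse ⊣ direct` with `inverse : E ⥤ F` and
`direct : F ⥤ E`, where `inverse` preserves finite limits. -/
structure GeometricMorphism (F E : Type (u + 1)) [Category.{u} F] [Category.{u} E] where
  inverse : E ⥤ F
  direct : F ⥤ E
  adj : inverse ⊣ direct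
  lex : PreservesFiniteLimits inverse

/-- An (orthogonal) factorization system `(L, R)` on a category. -/
structure IsFactorizationSystem {B : Type*} [Category* B] (L R : MorphismProperty B) : Prop where
  left_iso : ∀ ⦃X Y : B⦄ (f : X ⟶ Y), IsIso f → L f
  right_iso : ∀ ⦃X Y : B⦄ (f : X ⟶ Y), IsIso f → R f
  left_comp : ∀ ⦃X Y Z : B⦄ (f : X ⟶ Y) (g : Y ⟶ Z), L f → L g → L (f ≫ g)
  right_comp : ∀ ⦃X Y Z : B⦄ (f : X ⟶ Y) (g : Y ⟶ Z), R f → R g → R (f ≫ g)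
  factorization : ∀ ⦃X Y : B⦄ (f : X ⟶ Y),
    ∃ (H : B) (n : X ⟶ H) (v : H ⟶ Y), L n ∧ R v ∧ n ≫ v = f
  orthogonal : ∀ ⦃X Y Z W : B⦄ (l : X ⟶ Y) (r : Z ⟶ W) (a : X ⟶ Z) (b : Y ⟶ W),
    L l → R r → a ≫ r = l ≫ b → ∃! d : Y ⟶ Z, l ≫ d = a ∧ d ≫ r = b

/-- A saturated class of maps of finite presentation (that is, of maps between finitely
presentable objects) in a locally finitely presentable category `B`. -/
structure IsSaturatedClass {B : Type (u + 1)} [Category.{u} B] (V : MorphismProperty B) :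
    Prop where
  source_fp : ∀ ⦃X Y : B⦄ (f : X ⟶ Y), V f → IsFinitelyPresentable.{u} X
  target_fp : ∀ ⦃X Y : B⦄ (f : X ⟶ Y), V f → IsFinitelyPresentable.{u} Y
  comp : ∀ ⦃X Y Z : B⦄ (f : X ⟶ Y) (g : Y ⟶ Z), V f → V g → V (f ≫ g)
  iso : ∀ ⦃X Y : B⦄ (f : X ⟶ Y), IsFinitelyPresentable.{u} X → IsFinitelyPresentable.{u} Y →
    IsIso f → V f
  right_cancel : ∀ ⦃X Y Z : B⦄ (f : X ⟶ Y) (g : Y ⟶ Z), V f → V (f ≫ g) → V g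
  pushout : ∀ ⦃X Y X' Y' : B⦄ (f : X ⟶ Y) (a : X ⟶ X') (a' : Y ⟶ Y') (f' : X' ⟶ Y'),
    V f → IsFinitelyPresentable.{u} X' → IsPushout f a a' f' → V f'
  finite_colimits : ∀ (I : Type) [SmallCategory I] [FinCategory I],
    V.IsStableUnderColimitsOfShape I

section FiniteLimitTheory

/- A finite limit theory `T` is given by its syntactic category: a small category `C` with finite
limits. The category of `T`-models in a category `E` is `C ⥤ₗ E`, the category of finite limit
preserving functors `C ⥤ E` and natural transformations. -/

variable (C : Type u) [SmallCategory C]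

/-- The functor `Cᵒᵖ ⥤ T[Set]`, sending an object (a formula in context) to the model which it
presents, i.e. to its corepresentable functor; it identifies `Cᵒᵖ` with the category of finitely
presentable set-valued models. -/
noncomputable def presentedModel : Cᵒᵖ ⥤ (C ⥤ₗ Type u) :=
  ObjectProperty.lift _ coyoneda (fun X => by
    rw [leftExactFunctor_iff]
    infer_instance)

variable {C} in
lemma isFinitelyPresentable_presentedModel [HasFiniteLimits C] (c : C) :
    IsFinitelyPresentable.{u} ((presentedModel C).obj (Opposite.op c)) := by
  rw [isFinitelyPresentable_iff_preservesFilteredColimits]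
  refine ⟨fun I _ _ => ?_⟩
  have hP : (leftExactFunctor C (Type u)).IsClosedUnderColimitsOfShape I := by
    unfold leftExactFunctor
    infer_instance
  have hι : PreservesColimitsOfShape I (leftExactFunctor C (Type u)).ι := inferInstance
  let e : coyoneda.obj (Opposite.op ((presentedModel C).obj (Opposite.op c))) ≅
      (leftExactFunctor C (Type u)).ι ⋙ (evaluation C (Type u)).obj c :=
    NatIso.ofComponents
      (fun M => (((leftExactFunctor C (Type u)).fullyFaithfulι.homEquiv
        (X := (presentedModel C).obj (Opposite.op c)) (Y := M)).trans coyonedaEquiv).toIso)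
      (fun _ => rfl)
  exact preservesColimitsOfShape_of_natIso e.symm

/-- A geometry on the finite limit theory with syntactic category `C`: a saturated class `V` of
maps in the category of set-valued models, and a Grothendieck topology `J` on `C` whose covers are
generated by duals of maps in `V`: the arrows of a covering sieve which are dual to a map in `V`
already cover. -/
structure Geometry [HasFiniteLimits C] where
  V : MorphismProperty (C ⥤ₗ Type u)
  saturated : IsSaturatedClass V
  J : GrothendieckTopology C
  covers_generated : ∀ ⦃X : C⦄ (S : Sieve X), S ∈ J X →
    Sieve.generate (fun (Y : C) (f : Y ⟶ X) => S f ∧ V ((presentedModel C).map f.op)) ∈ J X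

variable {C}

/-- `F : C ⥤ E` is `J`-continuous: it sends `J`-covering families to epimorphic families. -/
def IsContinuousFor (J : GrothendieckTopology C) {E : Type (u + 1)} [Category.{u} E]
    [IsGrothendieckTopos E] (F : C ⥤ E) : Prop :=
  ∀ (X : C) (I : Type u) (Y : I → C) (s : ∀ i, Y i ⟶ X), Sieve.ofArrows Y s ∈ J X →
    Epi (Sigma.desc (fun i => F.map (s i)) : (∐ fun i => F.obj (Y i)) ⟶ F.obj X)

/-- The models in `E` of the geometric extension `T_J` of `T`: the models of `T` that are
`J`-continuous. -/
def IsExtensionModel (J : GrothendieckTopology C) {E : Type (u + 1)} [Category.{u} E]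
    [IsGrothendieckTopos E] (M : C ⥤ₗ E) : Prop :=
  IsContinuousFor J M.obj

variable (C) in
/-- The inverse image functor `g^* : T[E] ⥤ T[F]` of a geometric morphism `g : F ⟶ E`. -/
def GeometricMorphism.inverseImage {F E : Type (u + 1)} [Category.{u} F] [Category.{u} E]
    (g : GeometricMorphism F E) : (C ⥤ₗ E) ⥤ (C ⥤ₗ F) :=
  (LeftExactFunctor.whiskeringRight C E F).obj ⟨g.inverse, g.lex⟩

variable (C) in
/-- The direct image functor `g_* : T[F] ⥤ T[E]` of a geometric morphism `g : F ⟶ E`. -/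
def GeometricMorphism.directImage {F E : Type (u + 1)} [Category.{u} F] [Category.{u} E]
    (g : GeometricMorphism F E) : (C ⥤ₗ F) ⥤ (C ⥤ₗ E) :=
  (LeftExactFunctor.whiskeringRight C F E).obj
    ⟨g.direct, by
      rw [leftExactFunctor_iff]
      have := g.adj.rightAdjoint_preservesLimits
      infer_instance⟩

/-- The admissibility structures whose finite limit theory has syntactic category `C` and whose
geometric extension is the one defined by `J`. The 2-functor `Loc` is a sub-2-functor of
`E ↦ Arrow T[E]`, i.e. a class of arrows in each `T[E]` such that these classes are preserved by
inverse images (the action on geometric transformations is then induced, as `Loc[E]` is a full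
subcategory of `Arrow T[E]`). -/
structure IsAdmissibilityStructure (J : GrothendieckTopology C)
    (Loc : ∀ (E : Type (u + 1)) [Category.{u} E] [IsGrothendieckTopos E],
      MorphismProperty (C ⥤ₗ E)) : Prop where
  inverse_image : ∀ (F E : Type (u + 1)) [Category.{u} F] [Category.{u} E]
    [IsGrothendieckTopos F] [IsGrothendieckTopos E] (g : GeometricMorphism F E)
    ⦃M N : C ⥤ₗ E⦄ (v : M ⟶ N), Loc E v → Loc F ((g.inverseImage C).map v)
  iso : ∀ (E : Type (u + 1)) [Category.{u} E] [IsGrothendieckTopos E]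
    ⦃M N : C ⥤ₗ E⦄ (v : M ⟶ N), IsIso v → Loc E v
  left_cancel : ∀ (E : Type (u + 1)) [Category.{u} E] [IsGrothendieckTopos E]
    ⦃M N P : C ⥤ₗ E⦄ (f : M ⟶ N) (v : N ⟶ P), Loc E v → Loc E (f ≫ v) → Loc E f
  /-- Every `f` with target a model of the extension has a factorization through a model of the
  extension followed by an arrow in `Loc`, initial among all factorizations of `f` whose second
  part is in `Loc`. -/
  factorization : ∀ (E : Type (u + 1)) [Category.{u} E] [IsGrothendieckTopos E]
    ⦃M N : C ⥤ₗ E⦄ (f : M ⟶ N), IsExtensionModel J N →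
    ∃ (H : C ⥤ₗ E) (n : M ⟶ H) (v : H ⟶ N),
      Loc E v ∧ IsExtensionModel J H ∧ n ≫ v = f ∧
      ∀ (K : C ⥤ₗ E) (a : M ⟶ K) (w : K ⟶ N), Loc E w → a ≫ w = f →
        ∃! h : H ⟶ K, n ≫ h = a ∧ h ≫ w = v

namespace Geometry

variable [HasFiniteLimits C] (G : Geometry C)

/-- The arrows `y ⟶ x` of the syntactic category which are dual to a map `K_x ⟶ K_y` in `V`. -/
def dualClass : MorphismProperty C :=
  fun _ _ f => G.V ((presentedModel C).map f.op)

/-- The category `Vᵒᵖ`: the full subcategory of `Arrow C` on the duals of maps in `V`. -/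
abbrev VOp : Type u :=
  ObjectProperty.FullSubcategory (fun a : Arrow C => G.dualClass a.hom)

lemma dualClass_id (c : C) : G.dualClass (𝟙 c) := by
  have h := isFinitelyPresentable_presentedModel c
  exact G.saturated.iso _ h h inferInstance

/-- The functor `C ⥤ Vᵒᵖ` sending an object to its identity. -/
def idVOp : C ⥤ G.VOp :=
  ObjectProperty.lift _
    { obj := fun c => Arrow.mk (𝟙 c)
      map := fun f => Arrow.homMk f f (by simp) }
    (fun c => G.dualClass_id c)

/-- The functor `Vᵒᵖ ⥤ C` sending (the dual of) a map in `V` to (the dual of) its codomain. -/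
def codVOp : G.VOp ⥤ C :=
  ObjectProperty.ι _ ⋙ Arrow.leftFunc

variable {E : Type (u + 1)} [Category.{u} E]

/-- The arrow `f : M ⟶ N` of `T[E]` is the one that corresponds to the finite limit preserving
functor `P : Vᵒᵖ ⥤ E` (equivalently, to a geometric morphism `E ⟶ [V, Set]`): it is the composite of
the geometric morphism with the generic arrow. Explicitly, `M` is the restriction of `P` to
identities, `N` is the left Kan extension of `P` along the codomain functor, and `f` is the unit at
identities. -/
def Classifies (P : G.VOp ⥤ₗ E) {M N : C ⥤ₗ E} (f : M ⟶ N) : Prop :=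
  ∃ (i : M.obj ≅ G.idVOp ⋙ P.obj) (α : P.obj ⟶ G.codVOp ⋙ N.obj),
    N.obj.IsLeftKanExtension α ∧
    ∀ c : C, f.hom.app c = i.hom.app c ≫ α.app (G.idVOp.obj c)

variable (E)

/-- The class `Et[E]` of etale arrows in `T[E]`: the arrows that correspond to an object of
`Lex[Vᵒᵖ, E]`. -/
def Et : MorphismProperty (C ⥤ₗ E) :=
  fun _ _ f => ∃ P : G.VOp ⥤ₗ E, G.Classifies P f

/-- The class `Loc[E]` of local arrows in `T[E]`: the transformations whose naturality squares at
the duals of maps in `V` are pullbacks. -/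
def Loc : MorphismProperty (C ⥤ₗ E) :=
  fun M N v => ∀ ⦃y x : C⦄ (w : y ⟶ x), G.dualClass w →
    IsPullback (v.hom.app y) (M.obj.map w) (N.obj.map w) (v.hom.app x)

/-- `Et[E]` as a full subcategory of `Arrow T[E]`. -/
abbrev EtCat : Type (u + 1) :=
  ObjectProperty.FullSubcategory (fun a : Arrow (C ⥤ₗ E) => G.Et E a.hom)

/-- `Loc[E]` as a full subcategory of `Arrow T[E]`. -/
abbrev LocCat : Type (u + 1) :=
  ObjectProperty.FullSubcategory (fun a : Arrow (C ⥤ₗ E) => G.Loc E a.hom)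

/-- The inclusion of `Et[E]` in `Arrow T[E]`. -/
abbrev etIncl : G.EtCat E ⥤ Arrow (C ⥤ₗ E) := ObjectProperty.ι _

/-- The inclusion of `Loc[E]` in `Arrow T[E]`. -/
abbrev locIncl : G.LocCat E ⥤ Arrow (C ⥤ₗ E) := ObjectProperty.ι _

end Geometry

end FiniteLimitTheory

/-!
Sending `P` in `Lex[Vᵒᵖ, E]` to the arrow it classifies is left adjoint to sending `f : M ⟶ N` to
the functor `w ↦ M(dom w) ×_{N(dom w)} N(cod w)` of squares from maps in `V` to `f`. The unit of
this adjunction is invertible, so etale arrows are coreflective among all arrows of models, and the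
counit at `f`, an isomorphism on domains, is the local part of `f`. Etale arrows are orthogonal to
local ones by the universal property of the left Kan extension, because `r : Z ⟶ W` is local exactly
when `Z(cod w)` is the pullback of `Z(dom w)` and `W(cod w)`, naturally in `w`.

By Diaconescu's theorem, `P` extends along the Yoneda embedding to a lex cocontinuous functor `L`,
and the left Kan extension of `P` along the codomain functor is `c ↦ L (C(cod -, c))`, so finite
limits of its values are computed among presheaves on `Vᵒᵖ`. That the counit is local is checked
over the jointly epimorphic maps `P w ⟶ N c`, where it follows from the stability of `V` under
composition and pushout.

Direct images do not preserve left Kan extensions, but they preserve functors of squares: if `P`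
classifies `n`, then `g_* P` classifies the etale part of `g_* n`. Finally, a local arrow pulls back
the `J`-covers by duals of maps in `V`, and jointly epimorphic families in a topos are stable under
pullback.
-/

section FactorizationSystem

variable {B : Type*} [Category* B] {L R : MorphismProperty B}

lemma mem_left_of_exists_lift
    (left_comp_iso : ∀ ⦃X Y Z : B⦄ (f : X ⟶ Y) (g : Y ⟶ Z) [IsIso g], L f → L (f ≫ g))
    (factorization : ∀ ⦃X Y : B⦄ (f : X ⟶ Y),
      ∃ (H : B) (n : X ⟶ H) (v : H ⟶ Y), L n ∧ R v ∧ n ≫ v = f)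
    (orthogonal : ∀ ⦃X Y Z W : B⦄ (l : X ⟶ Y) (r : Z ⟶ W) (a : X ⟶ Z) (b : Y ⟶ W),
      L l → R r → a ≫ r = l ≫ b → ∃! d : Y ⟶ Z, l ≫ d = a ∧ d ≫ r = b)
    {X Y : B} (l : X ⟶ Y)
    (lift : ∀ ⦃Z : B⦄ (r : Z ⟶ Y) (a : X ⟶ Z), R r → a ≫ r = l →
      ∃ d : Y ⟶ Z, l ≫ d = a ∧ d ≫ r = 𝟙 Y) : L l := by
  obtain ⟨H, n, v, hn, hv, rfl⟩ := factorization l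
  obtain ⟨d, hd, hdv⟩ := lift v n hv rfl
  have hvd : v ≫ d = 𝟙 H :=
    (orthogonal n v n v hn hv rfl).unique ⟨by simpa using hd, by simp [hdv]⟩ (by simp)
  have : IsIso v := ⟨d, hvd, hdv⟩
  exact left_comp_iso n v hn

namespace IsFactorizationSystem

lemma of_orthogonal
    (right_iso : ∀ ⦃X Y : B⦄ (f : X ⟶ Y), IsIso f → R f)
    (right_comp : ∀ ⦃X Y Z : B⦄ (f : X ⟶ Y) (g : Y ⟶ Z), R f → R g → R (f ≫ g))
    (left_comp_iso : ∀ ⦃X Y Z : B⦄ (f : X ⟶ Y) (g : Y ⟶ Z) [IsIso g], L f → L (f ≫ g))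
    (factorization : ∀ ⦃X Y : B⦄ (f : X ⟶ Y),
      ∃ (H : B) (n : X ⟶ H) (v : H ⟶ Y), L n ∧ R v ∧ n ≫ v = f)
    (orthogonal : ∀ ⦃X Y Z W : B⦄ (l : X ⟶ Y) (r : Z ⟶ W) (a : X ⟶ Z) (b : Y ⟶ W),
      L l → R r → a ≫ r = l ≫ b → ∃! d : Y ⟶ Z, l ≫ d = a ∧ d ≫ r = b) :
    IsFactorizationSystem L R where
  left_iso X Y f _ := mem_left_of_exists_lift left_comp_iso factorization orthogonal f
    fun Z r a _ h => ⟨inv f ≫ a, by simp, by simp [h]⟩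
  right_iso := right_iso
  left_comp X Y Z f g hf hg :=
    mem_left_of_exists_lift left_comp_iso factorization orthogonal _ fun W r a hr h => by
      obtain ⟨d, ⟨hd, hdr⟩, -⟩ := orthogonal f r a g hf hr h
      obtain ⟨d', ⟨rfl, hd'⟩, -⟩ := orthogonal g r d (𝟙 Z) hg hr (by simpa using hdr)
      exact ⟨d', by simpa using hd, hd'⟩
  right_comp := right_comp
  factorization := factorization
  orthogonal := orthogonal

variable (h : IsFactorizationSystem L R)

/-- The middle object of a chosen `(L, R)`-factorization of `f`. -/
noncomputable def middle {X Y : B} (f : X ⟶ Y) : B := (h.factorization f).choose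

/-- The left part of a chosen `(L, R)`-factorization of `f`. -/
noncomputable def leftPart {X Y : B} (f : X ⟶ Y) : X ⟶ h.middle f :=
  (h.factorization f).choose_spec.choose

/-- The right part of a chosen `(L, R)`-factorization of `f`. -/
noncomputable def rightPart {X Y : B} (f : X ⟶ Y) : h.middle f ⟶ Y :=
  (h.factorization f).choose_spec.choose_spec.choose

lemma leftPart_mem {X Y : B} (f : X ⟶ Y) : L (h.leftPart f) :=
  (h.factorization f).choose_spec.choose_spec.choose_spec.1

lemma rightPart_mem {X Y : B} (f : X ⟶ Y) : R (h.rightPart f) :=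
  (h.factorization f).choose_spec.choose_spec.choose_spec.2.1

@[simp]
lemma leftPart_rightPart {X Y : B} (f : X ⟶ Y) : h.leftPart f ≫ h.rightPart f = f :=
  (h.factorization f).choose_spec.choose_spec.choose_spec.2.2

/-- The left class of a factorization system, as a full subcategory of the category of arrows. -/
abbrev LeftArrow (L : MorphismProperty B) : Type _ :=
  ObjectProperty.FullSubcategory (fun f : Arrow B => L f.hom)

/-- The left part of the factorization of an arrow, as an object of the left class. -/
noncomputable def leftArrow (f : Arrow B) : LeftArrow L :=
  ⟨Arrow.mk (h.leftPart f.hom), h.leftPart_mem f.hom⟩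

/-- The morphism of arrows from the left part of `f` to `f` given by the right part of `f`. -/
noncomputable def leftArrowHom (f : Arrow B) : (h.leftArrow f).obj ⟶ f :=
  Arrow.homMk (𝟙 _) (h.rightPart f.hom)
    ((Category.id_comp _).trans (h.leftPart_rightPart f.hom).symm)

lemma existsUnique_lift_leftArrowHom (X : LeftArrow L) (f : Arrow B) (a : X.obj ⟶ f) :
    ∃! k : X ⟶ h.leftArrow f, k.hom ≫ h.leftArrowHom f = a := by
  have left_comp_id (k : X.obj ⟶ (h.leftArrow f).obj) :
      (k ≫ h.leftArrowHom f).left = k.left := Category.comp_id _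
  obtain ⟨d, ⟨hd, hda⟩, d_unique⟩ := h.orthogonal X.obj.hom (h.rightPart f.hom)
    (a.left ≫ h.leftPart f.hom) a.right X.property (h.rightPart_mem _)
    ((Category.assoc _ _ _).trans ((congrArg _ (h.leftPart_rightPart f.hom)).trans a.w))
  refine ⟨ObjectProperty.homMk (Arrow.homMk a.left d hd.symm),
    Arrow.hom_ext _ _ (left_comp_id _) hda, fun k hk => ?_⟩
  subst hk
  rw [left_comp_id] at d_unique
  exact ObjectProperty.hom_ext _ (Arrow.hom_ext _ _ (left_comp_id _).symm
    (d_unique k.hom.right ⟨k.hom.w.symm, rfl⟩))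

/-- The universal property of the left part of an arrow, as a bijection of sets of morphisms. -/
noncomputable def leftArrowHomEquiv (X : LeftArrow L) (f : Arrow B) :
    (X.obj ⟶ f) ≃ (X ⟶ h.leftArrow f) :=
  (Equiv.ofBijective (fun k : X ⟶ h.leftArrow f => k.hom ≫ h.leftArrowHom f)
    ((Function.bijective_iff_existsUnique _).2 (h.existsUnique_lift_leftArrowHom X f))).symm

lemma leftArrowHomEquiv_naturality (X' X : LeftArrow L) (f : Arrow B) (k : X' ⟶ X)
    (a : X.obj ⟶ f) :
    h.leftArrowHomEquiv X' f (k.hom ≫ a) = k ≫ h.leftArrowHomEquiv X f a := by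
  refine (Equiv.symm_apply_eq _).2 ?_
  have := (h.leftArrowHomEquiv X f).symm_apply_apply a
  exact (congrArg (k.hom ≫ ·) this).symm.trans (Category.assoc _ _ _).symm

/-- The functor sending an arrow to the left part of its factorization. -/
noncomputable def leftArrowFunctor : Arrow B ⥤ LeftArrow L :=
  Adjunction.rightAdjointOfEquiv (F := ObjectProperty.ι _) h.leftArrowHomEquiv
    h.leftArrowHomEquiv_naturality

/-- The left class of a factorization system is coreflective in the category of arrows. -/
noncomputable def leftArrowAdjunction : ObjectProperty.ι _ ⊣ h.leftArrowFunctor :=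
  Adjunction.adjunctionOfEquivRight (F := ObjectProperty.ι _) h.leftArrowHomEquiv
    h.leftArrowHomEquiv_naturality

end IsFactorizationSystem

end FactorizationSystem

/-- The adjunction between categories of arrows induced by an adjunction. -/
def mapArrowAdjunction {A B : Type*} [Category* A] [Category* B] {L : A ⥤ B} {R : B ⥤ A}
    (adj : L ⊣ R) : L.mapArrow ⊣ R.mapArrow where
  unit := (Functor.mapArrowFunctor A A).map adj.unit
  counit := (Functor.mapArrowFunctor B B).map adj.counit
  left_triangle_components f := Arrow.hom_ext _ _ (adj.left_triangle_components f.left)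
    (adj.left_triangle_components f.right)
  right_triangle_components f := Arrow.hom_ext _ _ (adj.right_triangle_components f.left)
    (adj.right_triangle_components f.right)

section ModelAdjunction

variable (C : Type u) [SmallCategory C] {F E : Type (u + 1)} [Category.{u} F] [Category.{u} E]

/-- The inverse image of models along a geometric morphism is left adjoint to the direct image. -/
noncomputable def GeometricMorphism.modelAdj (g : GeometricMorphism F E) :
    g.inverseImage C ⊣ g.directImage C :=
  (g.adj.whiskerRight C).restrictFullyFaithful (leftExactFunctor C E).fullyFaithfulι
    (leftExactFunctor C F).fullyFaithfulι (Iso.refl _) (Iso.refl _)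

end ModelAdjunction

namespace IsGrothendieckTopos

variable (E : Type (u + 1)) [Category.{u} E] [IsGrothendieckTopos E]

lemma exists_reflection : ∃ (D : Type u) (_ : SmallCategory D) (L : (Dᵒᵖ ⥤ Type u) ⥤ E)
    (R : E ⥤ Dᵒᵖ ⥤ Type u) (_ : L ⊣ R), R.Full ∧ R.Faithful ∧ PreservesFiniteLimits L := by
  obtain ⟨D, _, K, ⟨e⟩⟩ := exists_site (E := E)
  exact ⟨D, inferInstance, presheafToSheaf K _ ⋙ e.inverse, e.functor ⋙ sheafToPresheaf K _,
    (sheafificationAdjunction K _).comp e.symm.toAdjunction, inferInstance, inferInstance,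
    inferInstance⟩

end IsGrothendieckTopos

section YonedaExtension

variable {A : Type u} [SmallCategory A]

section

variable {C : Type u} [SmallCategory C]

/-- The functor `c ↦ C(F -, c)`, the left Kan extension of the Yoneda embedding along `F`. -/
abbrev restrictedYoneda (F : A ⥤ C) : C ⥤ Aᵒᵖ ⥤ Type u :=
  yoneda ⋙ (Functor.whiskeringLeft _ _ _).obj F.op

/-- The action of `F` on morphisms, as the unit of the left Kan extension `restrictedYoneda F`. -/
abbrev restrictedYonedaUnit (F : A ⥤ C) : yoneda ⟶ F ⋙ restrictedYoneda F where
  app := yonedaMap F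

/-- The presheaf `C(F -, c)` is the colimit of the representables over its category of elements. -/
def restrictedYonedaIsPointwiseLeftKanExtension (F : A ⥤ C) :
    (Functor.LeftExtension.mk (restrictedYoneda F)
      (restrictedYonedaUnit F)).IsPointwiseLeftKanExtension := fun c =>
  { desc s :=
      { app a := ↾ fun t => yonedaEquiv (s.ι.app (CostructuredArrow.mk (Y := a.unop) t))
        naturality a b g := by
          ext t
          let k : CostructuredArrow.mk (S := F) (F.map g.unop ≫ t) ⟶ CostructuredArrow.mk t :=
            CostructuredArrow.homMk g.unop
          refine (congrArg yonedaEquiv (s.w k)).symm.trans ?_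
          exact (yonedaEquiv_naturality _ _).symm }
    fac s j := by
      have hj : F.map (𝟙 _) ≫ j.hom = j.hom := by simp
      exact yonedaEquiv.injective
        (congrArg (fun t => yonedaEquiv (s.ι.app (CostructuredArrow.mk t))) hj)
    uniq s m hm := by
      ext a t
      have ht : F.map (𝟙 _) ≫ t = t := by rw [F.map_id]; exact Category.id_comp _
      refine (congrArg (m.app a) ht).symm.trans ?_
      exact congrArg yonedaEquiv (hm (CostructuredArrow.mk t)) }

end

lemma exists_lexExtension_type [HasFiniteLimits A] (P : A ⥤ Type u) [PreservesFiniteLimits P] :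
    ∃ T : (Aᵒᵖ ⥤ Type u) ⥤ Type u, PreservesFiniteLimits T ∧ PreservesColimits T ∧
      Nonempty (P ≅ uliftYoneda.{u} ⋙ T) := by
  have := P.isCofiltered_elements
  exact ⟨(Functor.whiskeringLeft _ _ _).obj (CategoryOfElements.π P).op ⋙ colim,
    inferInstance, inferInstance,
    ⟨(Functor.Elements.shrinkYonedaCompWhiskeringLeftObjπCompColimIso P).symm ≪≫
      Functor.isoWhiskerRight uliftYonedaIsoShrinkYoneda.{u}.symm _⟩⟩

lemma preservesFiniteLimits_leftKanExtension_uliftYoneda [HasFiniteLimits A] {D : Type u}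
    [SmallCategory D] (Q : A ⥤ D ⥤ Type u) [PreservesFiniteLimits Q] :
    PreservesFiniteLimits (uliftYoneda.{u}.leftKanExtension Q) := by
  refine ⟨fun J _ _ => preservesLimitsOfShape_of_evaluation _ _ fun d => ?_⟩
  obtain ⟨T, _, _, ⟨e⟩⟩ := exists_lexExtension_type (Q ⋙ (evaluation D (Type u)).obj d)
  have : PreservesColimits (uliftYoneda.{u}.leftKanExtension Q) :=
    Presheaf.preservesColimitsOfSize_leftKanExtension.{u} Q
  let i : uliftYoneda.{u}.leftKanExtension Q ⋙ (evaluation D (Type u)).obj d ≅ T :=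
    Presheaf.uniqueExtensionAlongULiftYoneda.{u} _
        (Functor.isoWhiskerRight (Presheaf.isExtensionAlongULiftYoneda.{u} Q).symm _ ≪≫
          Functor.associator _ _ _) ≪≫
      (Presheaf.uniqueExtensionAlongULiftYoneda.{u} T e).symm
  exact preservesLimitsOfShape_of_natIso i.symm

lemma IsGrothendieckTopos.exists_lexExtension [HasFiniteLimits A] {E : Type (u + 1)}
    [Category.{u} E] [IsGrothendieckTopos E] (P : A ⥤ E) [PreservesFiniteLimits P] :
    ∃ L : (Aᵒᵖ ⥤ Type u) ⥤ E, PreservesFiniteLimits L ∧ PreservesColimits L ∧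
      Nonempty (yoneda ⋙ L ≅ P) := by
  obtain ⟨D, _, S, R, adj, _, _, _⟩ := IsGrothendieckTopos.exists_reflection E
  have := adj.rightAdjoint_preservesLimits
  have := adj.leftAdjoint_preservesColimits
  let T := uliftYoneda.{u}.leftKanExtension (P ⋙ R)
  have : PreservesFiniteLimits T := preservesFiniteLimits_leftKanExtension_uliftYoneda (P ⋙ R)
  have : PreservesColimits T := Presheaf.preservesColimitsOfSize_leftKanExtension.{u} (P ⋙ R)
  exact ⟨T ⋙ S, inferInstance, inferInstance,
    ⟨Functor.isoWhiskerRight uliftYonedaIsoYoneda.{u}.symm _ ≪≫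
      Functor.isoWhiskerRight (Presheaf.isExtensionAlongULiftYoneda.{u} (P ⋙ R)) S ≪≫
      Functor.isoWhiskerLeft P (asIso adj.counit)⟩⟩

end YonedaExtension

section LeftKanExtension

variable {A C : Type u} [SmallCategory A] [SmallCategory C] [HasFiniteLimits A]
  {E : Type (u + 1)} [Category.{u} E] [IsGrothendieckTopos E]

/- Every left Kan extension of `P` is the restricted Yoneda functor followed by `L`, so that finite
limits of values of the extension can be computed in presheaves. -/
lemma exists_lexExtension_of_isLeftKanExtension {F : A ⥤ C} {P : A ⥤ E} [PreservesFiniteLimits P]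
    {N : C ⥤ E} (α : P ⟶ F ⋙ N) [N.IsLeftKanExtension α] :
    ∃ (L : (Aᵒᵖ ⥤ Type u) ⥤ E) (e : yoneda ⋙ L ≅ P) (i : restrictedYoneda F ⋙ L ≅ N),
      PreservesFiniteLimits L ∧
        ∀ a, L.map (yonedaMap F a) ≫ i.hom.app (F.obj a) = e.hom.app a ≫ α.app a := by
  obtain ⟨L, _, _, ⟨e⟩⟩ := IsGrothendieckTopos.exists_lexExtension P
  have : (restrictedYoneda F).IsLeftKanExtension (restrictedYonedaUnit F) :=
    (restrictedYonedaIsPointwiseLeftKanExtension F).isLeftKanExtension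
  let β : yoneda ⋙ L ⟶ F ⋙ restrictedYoneda F ⋙ L :=
    Functor.whiskerRight (restrictedYonedaUnit F) L ≫ (Functor.associator _ _ _).hom
  have : (restrictedYoneda F ⋙ L).IsLeftKanExtension β :=
    Functor.PreservesLeftKanExtension.preserves (restrictedYoneda F) (restrictedYonedaUnit F)
  have : N.IsLeftKanExtension (e.hom ≫ α) :=
    (Functor.isLeftKanExtension_iff_of_iso₂ α _ e.symm (Iso.refl N) (by simp)).1 inferInstance
  refine ⟨L, e, Functor.leftKanExtensionUnique _ β N (e.hom ≫ α), inferInstance, fun a => ?_⟩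
  have := (restrictedYoneda F ⋙ L).descOfIsLeftKanExtension_fac_app β N (e.hom ≫ α) a
  simpa [β, Functor.leftKanExtensionUnique] using this

lemma preservesFiniteLimits_of_isLeftKanExtension {F : A ⥤ C} {P : A ⥤ E}
    [PreservesFiniteLimits P] {N : C ⥤ E} (α : P ⟶ F ⋙ N) [N.IsLeftKanExtension α] :
    PreservesFiniteLimits N := by
  obtain ⟨L, -, i, _, -⟩ := exists_lexExtension_of_isLeftKanExtension α
  exact preservesFiniteLimits_of_natIso i

end LeftKanExtension

lemma epi_sigmaDesc_iff {E : Type*} [Category* E] {I : Type*} {A : I → E} [HasCoproduct A] {B : E}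
    (s : ∀ i, A i ⟶ B) :
    Epi (Sigma.desc s) ↔ ∀ ⦃T : E⦄ (h h' : B ⟶ T), (∀ i, s i ≫ h = s i ≫ h') → h = h' where
  mp _ T h h' e := by
    rw [← cancel_epi (Sigma.desc s)]
    ext i
    simpa using e i
  mpr hs := ⟨fun h h' e => hs h h' fun i => by simpa using Sigma.ι A i ≫= e⟩

section Presheaf

variable {D : Type*} [Category* D] {I : Type*}

lemma isPullback_fromPreimage_ι {X Y : D ⥤ Type u} (S : Subfunctor Y) (p : X ⟶ Y) :
    IsPullback (S.fromPreimage p) (S.preimage p).ι S.ι p :=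
  IsPullback.of_forall_isPullback_app fun d => by
    have mem_preimage (y : S.obj d) (x : X.obj d) (h : y.1 = p.app d x) :
        x ∈ (S.preimage p).obj d := by
      rw [Subfunctor.preimage_obj, Set.mem_preimage, ← h]
      exact y.2
    exact (Types.isPullback_iff _ _ _ _).2 ⟨rfl, fun _ _ h => Subtype.ext h.2, fun y x h =>
      ⟨⟨x, mem_preimage y x h⟩, Subtype.ext h.symm, rfl⟩⟩

lemma iSup_range_eq_preimage_of_isPullback {A A' : I → D ⥤ Type u} {B B' : D ⥤ Type u}
    {s : ∀ i, A i ⟶ B} {s' : ∀ i, A' i ⟶ B'} {t' : ∀ i, A' i ⟶ A i} {t : B' ⟶ B}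
    (h : ∀ i, IsPullback (t' i) (s' i) (s i) t) :
    ⨆ i, Subfunctor.range (s' i) = (⨆ i, Subfunctor.range (s i)).preimage t := by
  ext d y
  simp only [Subfunctor.iSup_obj, Subfunctor.range_obj, Subfunctor.preimage_obj, Set.mem_preimage,
    Set.mem_iUnion, Set.mem_range]
  constructor
  · rintro ⟨i, x, rfl⟩
    exact ⟨i, (t' i).app d x, ConcreteCategory.congr_hom (congr_app (h i).w d) x⟩
  · rintro ⟨i, x, hx⟩
    obtain ⟨x', -, hx'⟩ := Types.exists_of_isPullback ((h i).app d) x y hx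
    exact ⟨i, x', hx'⟩

/- The counit being invertible, maps out of `B` agree if and only if their images under `R` agree
on a subpresheaf which the reflection inverts. -/
lemma epi_sigmaDesc_iff_isIso_map_iSup_range {E : Type*} [Category* E] [Balanced E]
    {L : (D ⥤ Type u) ⥤ E} {R : E ⥤ D ⥤ Type u} (adj : L ⊣ R) [R.Full] [R.Faithful]
    [PreservesFiniteLimits L] {A : I → E} [HasCoproduct A] {B : E} (s : ∀ i, A i ⟶ B) :
    Epi (Sigma.desc s) ↔ IsIso (L.map (⨆ i, Subfunctor.range (R.map (s i))).ι) := by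
  set S := ⨆ i, Subfunctor.range (R.map (s i))
  rw [epi_sigmaDesc_iff]
  constructor
  · intro hs
    have : Mono (L.map S.ι) := inferInstance
    have : Epi (L.map S.ι ≫ adj.counit.app B) := ⟨fun k k' e => hs _ _ fun i => by
      let p : R.obj (A i) ⟶ S.toFunctor :=
        Subfunctor.lift (R.map (s i)) (le_iSup (fun i => Subfunctor.range (R.map (s i))) i)
      have hp : L.map p ≫ L.map S.ι ≫ adj.counit.app B = adj.counit.app (A i) ≫ s i := by
        rw [← L.map_comp_assoc, Subfunctor.lift_ι]
        exact adj.counit_naturality (s i)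
      rw [← cancel_epi (adj.counit.app (A i)), ← reassoc_of% hp, ← reassoc_of% hp]
      simpa using L.map p ≫= e⟩
    have : IsIso (L.map S.ι ≫ adj.counit.app B) := isIso_of_mono_of_epi _
    exact IsIso.of_isIso_comp_right _ (adj.counit.app B)
  · intro _ T k k' e
    have hS : S.ι ≫ R.map k = S.ι ≫ R.map k' := by
      ext d ⟨y, hy⟩
      obtain ⟨i, a, rfl⟩ := Set.mem_iUnion.1 ((Subfunctor.iSup_obj _ d).le hy)
      have hR : R.map (s i) ≫ R.map k = R.map (s i) ≫ R.map k' := by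
        rw [← R.map_comp, e, R.map_comp]
      exact ConcreteCategory.congr_hom (congr_app hR d) a
    have hR : L.map (R.map k) = L.map (R.map k') := by
      rw [← cancel_epi (L.map S.ι), ← L.map_comp, ← L.map_comp, hS]
    refine (cancel_epi (adj.counit.app B)).1 ((adj.counit_naturality k).symm.trans ?_)
    exact (hR =≫ _).trans (adj.counit_naturality k')

end Presheaf

namespace IsGrothendieckTopos

variable {E : Type (u + 1)} [Category.{u} E] [IsGrothendieckTopos E]

instance : HasFiniteLimits E := by
  obtain ⟨D, _, K, ⟨e⟩⟩ := exists_site (E := E)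
  exact ⟨fun _ _ _ => Adjunction.hasLimitsOfShape_of_equivalence e.functor⟩

instance : Balanced E := by
  obtain ⟨D, _, K, ⟨e⟩⟩ := exists_site (E := E)
  refine ⟨fun f _ _ => ?_⟩
  have := isIso_of_mono_of_epi (e.functor.map f)
  exact isIso_of_reflects_iso f e.functor

lemma epi_sigmaDesc_of_isPullback {I : Type u} {A A' : I → E} {B B' : E} {s : ∀ i, A i ⟶ B}
    {s' : ∀ i, A' i ⟶ B'} {t' : ∀ i, A' i ⟶ A i} {t : B' ⟶ B}
    (h : ∀ i, IsPullback (t' i) (s' i) (s i) t) (hs : Epi (Sigma.desc s)) :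
    Epi (Sigma.desc s') := by
  obtain ⟨D, _, L, R, adj, _, _, _⟩ := exists_reflection E
  have : PreservesLimits R := adj.rightAdjoint_preservesLimits
  rw [epi_sigmaDesc_iff_isIso_map_iSup_range adj] at hs ⊢
  rw [iSup_range_eq_preimage_of_isPullback fun i => (h i).map R]
  exact ((isPullback_fromPreimage_ι _ (R.map t)).map L).isIso_snd_of_isIso

/- The comparison map from `X` to the pullback is epimorphic because the `X' i` cover the pullback,
and monomorphic because two maps to `X` which it equalizes agree over each `B' i`. -/
lemma isPullback_of_epi_sigmaDesc {I : Type u} {X Y B D : E} {f : X ⟶ Y} {p : X ⟶ B} {q : Y ⟶ D}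
    {g : B ⟶ D} (w : f ≫ q = p ≫ g) {B' X' : I → E} {b : ∀ i, B' i ⟶ B}
    (hb : Epi (Sigma.desc b)) {x : ∀ i, X' i ⟶ X} {p' : ∀ i, X' i ⟶ B' i}
    (hX : ∀ i, IsPullback (x i) (p' i) p (b i))
    (hY : ∀ i, IsPullback (x i ≫ f) (p' i) q (b i ≫ g)) : IsPullback f p q g := by
  let φ : X ⟶ pullback q g := pullback.lift f p w
  have hf : φ ≫ pullback.fst q g = f := pullback.lift_fst f p w
  have hp : φ ≫ pullback.snd q g = p := pullback.lift_snd f p w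
  have hφ (i : I) : IsPullback (p' i) (x i ≫ φ) (b i) (pullback.snd q g) :=
    (IsPullback.of_right (by simpa [hf] using hY i) (by simp [hp, (hX i).w])
      (IsPullback.of_hasPullback q g)).flip
  have : Epi φ := by
    have := epi_sigmaDesc_of_isPullback hφ hb
    rw [epi_sigmaDesc_iff] at this
    exact ⟨fun k k' h => this k k' fun i => by simp [h]⟩
  have : Mono φ := ⟨fun {T} a a' h => by
    have hap : a ≫ p = a' ≫ p := by simp only [← hp, reassoc_of% h]
    have haf : a ≫ f = a' ≫ f := by simp only [← hf, reassoc_of% h]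
    have := epi_sigmaDesc_of_isPullback
      (fun i => (IsPullback.of_hasPullback (a ≫ p) (b i)).flip) hb
    rw [epi_sigmaDesc_iff] at this
    refine this a a' fun i => ?_
    have ha : (pullback.fst (a ≫ p) (b i) ≫ a) ≫ p = pullback.snd (a ≫ p) (b i) ≫ b i :=
      (Category.assoc _ _ _).trans pullback.condition
    have ha' : (pullback.fst (a ≫ p) (b i) ≫ a') ≫ p = pullback.snd (a ≫ p) (b i) ≫ b i :=
      (Category.assoc _ _ _).trans ((_ ≫= hap.symm).trans pullback.condition)
    rw [← (hX i).lift_fst _ _ ha, ← (hX i).lift_fst _ _ ha']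
    congr 1
    refine (hY i).hom_ext ?_ (by simp only [IsPullback.lift_snd])
    simp only [IsPullback.lift_fst_assoc, Category.assoc, haf]⟩
  have : IsIso φ := isIso_of_mono_of_epi φ
  exact IsPullback.of_iso_pullback ⟨w⟩ (asIso φ) hf hp

end IsGrothendieckTopos

section Comma

variable {A B T : Type*} [Category* A] [Category* B] [Category* T] (L : A ⥤ T) (R : B ⥤ T)
  [HasFiniteLimits A] [HasFiniteLimits B] [PreservesFiniteLimits R]

lemma preservesFiniteLimits_commaFst : PreservesFiniteLimits (Comma.fst L R) where
  preservesFiniteLimits _ _ _ := ⟨fun {K} =>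
    preservesLimit_of_preserves_limit_cone
      (Comma.coneOfPreservesIsLimit K (limit.isLimit _) (limit.isLimit _)) (limit.isLimit _)⟩

lemma preservesFiniteLimits_commaSnd : PreservesFiniteLimits (Comma.snd L R) where
  preservesFiniteLimits _ _ _ := ⟨fun {K} =>
    preservesLimit_of_preserves_limit_cone
      (Comma.coneOfPreservesIsLimit K (limit.isLimit _) (limit.isLimit _)) (limit.isLimit _)⟩

end Comma

section Limit

variable {I J E : Type*} [Category* I] [Category* J] [Category* E]

lemma preservesFiniteLimits_limit [HasLimitsOfShape I E] (K : I ⥤ J ⥤ E)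
    (hK : ∀ i, PreservesFiniteLimits (K.obj i)) : PreservesFiniteLimits (limit K) := by
  have : PreservesFiniteLimits K.flip := preservesFiniteLimits_of_evaluation _ hK
  exact preservesFiniteLimits_of_natIso (limitIsoFlipCompLim K).symm

end Limit

section PresentedModel

variable {C : Type u} [SmallCategory C]

/-- The Yoneda lemma for models: maps from the model presented by `c` to `M` are the elements of
`M` at `c`. -/
noncomputable def presentedModelOpCompYonedaIso (M : C ⥤ₗ Type u) :
    (presentedModel C).op ⋙ yoneda.obj M ≅ (opOpEquivalence C).functor ⋙ M.obj :=
  NatIso.ofComponents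
    (fun X => (((leftExactFunctor C (Type u)).fullyFaithfulι.homEquiv
      (X := (presentedModel C).obj X.unop) (Y := M)).trans coyonedaEquiv).toIso)
    (fun {X Y} f => by
      ext g
      have := ConcreteCategory.congr_hom (g.hom.naturality f.unop.unop) (𝟙 X.unop.unop)
      refine Eq.trans ?_ this
      change g.hom.app Y.unop.unop (f.unop.unop ≫ 𝟙 _) = g.hom.app _ (𝟙 _ ≫ f.unop.unop)
      rw [Category.comp_id, Category.id_comp])

instance [HasFiniteLimits C] : PreservesFiniteColimits (presentedModel C) where
  preservesFiniteColimits I _ _ := ⟨fun {K} => ⟨fun {c} hc => ⟨by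
    refine (Cocone.isColimitYonedaEquiv _).symm fun M => ?_
    have : PreservesFiniteLimits M.obj := M.property
    have : PreservesFiniteLimits ((presentedModel C).op ⋙ yoneda.obj M) :=
      preservesFiniteLimits_of_natIso (presentedModelOpCompYonedaIso M).symm
    exact isLimitOfPreserves ((presentedModel C).op ⋙ yoneda.obj M) hc.op⟩⟩⟩

end PresentedModel

namespace Geometry

variable {C : Type u} [SmallCategory C] [HasFiniteLimits C] (G : Geometry C)

section DualClass

variable {G}

lemma dualClass_comp {x y z : C} {f : x ⟶ y} {g : y ⟶ z} (hf : G.dualClass f)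
    (hg : G.dualClass g) : G.dualClass (f ≫ g) := by
  unfold dualClass at *
  rw [op_comp, Functor.map_comp]
  exact G.saturated.comp _ _ hg hf

lemma dualClass_of_isPullback {x y x' y' : C} {f' : y' ⟶ x'} {a' : y' ⟶ y} {a : x' ⟶ x}
    {f : y ⟶ x} (h : IsPullback f' a' a f) (hf : G.dualClass f) : G.dualClass f' :=
  G.saturated.pushout _ _ _ _ hf (isFinitelyPresentable_presentedModel x')
    (h.flip.op.flip.map (presentedModel C))

instance isClosedUnderLimitsOfShape_dualClass (J : Type) [SmallCategory J] [FinCategory J] :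
    ObjectProperty.IsClosedUnderLimitsOfShape
      (fun a : Arrow C => G.dualClass a.hom) J := by
  constructor
  rintro X ⟨p⟩
  have : PreservesFiniteLimits Arrow.leftFunc := preservesFiniteLimits_commaFst (𝟭 C) (𝟭 C)
  have : PreservesFiniteLimits Arrow.rightFunc := preservesFiniteLimits_commaSnd (𝟭 C) (𝟭 C)
  have hl := isColimitOfPreserves (presentedModel C)
    (isLimitOfPreserves Arrow.leftFunc p.isLimit).op
  have hr := isColimitOfPreserves (presentedModel C)
    (isLimitOfPreserves Arrow.rightFunc p.isLimit).op
  exact (G.saturated.finite_colimits Jᵒᵖ).condition _ _ _ _ hr hl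
    (Functor.whiskerRight (NatTrans.op (Functor.whiskerLeft p.diag Arrow.leftToRight))
      (presentedModel C))
    (fun j => p.prop_diag_obj j.unop) ((presentedModel C).map X.hom.op)
    (fun j => by
      have := congrArg (fun f => (presentedModel C).map (Quiver.Hom.op f)) (p.π.app j.unop).w.symm
      simp only [op_comp, Functor.map_comp] at this
      exact this)

end DualClass

instance : HasFiniteLimits G.VOp := ⟨fun _ _ _ => inferInstance⟩

/-- The functor `Vᵒᵖ ⥤ C` sending (the dual of) a map in `V` to (the dual of) its domain. -/
def domVOp : G.VOp ⥤ C :=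
  ObjectProperty.ι _ ⋙ Arrow.rightFunc

/-- The natural transformation whose components are the duals of the maps in `V`. -/
def codToDom : G.codVOp ⟶ G.domVOp :=
  Functor.whiskerLeft _ Arrow.leftToRight

instance : PreservesFiniteLimits (ObjectProperty.ι (fun a : Arrow C => G.dualClass a.hom)) :=
  ⟨fun _ _ _ => inferInstance⟩

instance : PreservesFiniteLimits G.codVOp := by
  have : PreservesFiniteLimits Arrow.leftFunc := preservesFiniteLimits_commaFst (𝟭 C) (𝟭 C)
  unfold codVOp
  infer_instance

instance : PreservesFiniteLimits G.domVOp := by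
  have : PreservesFiniteLimits Arrow.rightFunc := preservesFiniteLimits_commaSnd (𝟭 C) (𝟭 C)
  unfold domVOp
  infer_instance

variable {G} in
lemma VOp.hom_ext {w w' : G.VOp} {f g : w ⟶ w'} (h₁ : G.codVOp.map f = G.codVOp.map g)
    (h₂ : G.domVOp.map f = G.domVOp.map g) : f = g :=
  ObjectProperty.hom_ext _ (Arrow.hom_ext _ _ h₁ h₂)

/-- The unit of the adjunction `domVOp ⊣ idVOp`: the square from `w` to the identity of its
domain. -/
def unitIdVOp : 𝟭 G.VOp ⟶ G.domVOp ⋙ G.idVOp where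
  app w := ObjectProperty.homMk (Arrow.homMk w.obj.hom (𝟙 _) rfl)
  naturality _ _ f := VOp.hom_ext f.hom.w ((Category.comp_id _).trans (Category.id_comp _).symm)

lemma unitIdVOp_app_idVOp (c : C) : G.unitIdVOp.app (G.idVOp.obj c) = 𝟙 _ :=
  VOp.hom_ext rfl rfl

section

variable {G}

/-- The dual of a map in `V` obtained by precomposing `w` with another dual of a map in `V`. -/
def precompVOp (w : G.VOp) {y : C} (i : y ⟶ G.codVOp.obj w) (hi : G.dualClass i) : G.VOp :=
  ⟨Arrow.mk (i ≫ w.obj.hom), dualClass_comp hi w.property⟩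

/-- The morphism from `precompVOp w i` to `w` which is `i` on codomains and the identity on
domains. -/
def precompVOpHom (w : G.VOp) {y : C} (i : y ⟶ G.codVOp.obj w) (hi : G.dualClass i) :
    precompVOp w i hi ⟶ w :=
  ObjectProperty.homMk (Arrow.homMk i (𝟙 _) (Category.comp_id _).symm)

end

section Squares

variable {E : Type*} [Category* E]

/-- For a transformation `f : M ⟶ N`, the transformations `β` and `α` exhibit `P` as the functor
sending the dual `w : y ⟶ x` of a map in `V` to the object of squares from `w` to `f`, that is to
the pullback of `f.app x` and `N.map w`. -/
abbrev IsSquaresFunctor {M N : C ⥤ E} (f : M ⟶ N) {P : G.VOp ⥤ E} (β : P ⟶ G.domVOp ⋙ M)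
    (α : P ⟶ G.codVOp ⋙ N) : Prop :=
  IsPullback β α (Functor.whiskerLeft G.domVOp f) (Functor.whiskerRight G.codToDom N)

section

variable [HasPullbacks E] {M N : C ⥤ E} (f : M ⟶ N)

/-- The functor sending the dual `w` of a map in `V` to the object of squares from `w` to `f`. -/
noncomputable def squares : G.VOp ⥤ E :=
  pullback (Functor.whiskerLeft G.domVOp f) (Functor.whiskerRight G.codToDom N)

/-- The restriction of squares to the domain of `f`. -/
noncomputable def squaresFst : G.squares f ⟶ G.domVOp ⋙ M := pullback.fst _ _

/-- The restriction of squares to the codomain of `f`. -/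
noncomputable def squaresSnd : G.squares f ⟶ G.codVOp ⋙ N := pullback.snd _ _

lemma isSquaresFunctor_squares : G.IsSquaresFunctor f (G.squaresFst f) (G.squaresSnd f) :=
  IsPullback.of_hasPullback _ _

lemma preservesFiniteLimits_squares [PreservesFiniteLimits M] [PreservesFiniteLimits N] :
    PreservesFiniteLimits (G.squares f) :=
  preservesFiniteLimits_limit _ (by
    rintro (_ | _ | _) <;> dsimp only [cospan_left, cospan_right, cospan_one] <;> infer_instance)

instance isIso_whiskerLeft_squaresFst : IsIso (Functor.whiskerLeft G.idVOp (G.squaresFst f)) :=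
  have (c : C) : IsIso ((Functor.whiskerLeft G.idVOp (G.squaresFst f)).app c) :=
    ((G.isSquaresFunctor_squares f).app (G.idVOp.obj c)).isIso_fst_of_isIso
      (inst := inferInstanceAs (IsIso (N.map (𝟙 c))))
  NatIso.isIso_of_isIso_app _

/-- The identification of the domain of `f` with the squares from identities to `f`. -/
noncomputable def domIsoSquares : M ≅ G.idVOp ⋙ G.squares f :=
  (asIso (Functor.whiskerLeft G.idVOp (G.squaresFst f))).symm

lemma domIsoSquares_hom_comp_squaresSnd (c : C) :
    (G.domIsoSquares f).hom.app c ≫ (G.squaresSnd f).app (G.idVOp.obj c) = f.app c := by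
  have w := ((G.isSquaresFunctor_squares f).app (G.idVOp.obj c)).w
  refine (_ ≫= ((_ ≫= N.map_id c).trans (Category.comp_id _)).symm.trans w.symm).trans ?_
  exact Iso.inv_hom_id_app_assoc (asIso (Functor.whiskerLeft G.idVOp (G.squaresFst f))) c _

end

variable {G} {P : G.VOp ⥤ E}

lemma IsSquaresFunctor.isPullback_precompVOpHom [HasPullbacks E] {M N : C ⥤ E} {f : M ⟶ N}
    {β : P ⟶ G.domVOp ⋙ M} {α : P ⟶ G.codVOp ⋙ N} (h : G.IsSquaresFunctor f β α) (w : G.VOp)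
    {y : C} (i : y ⟶ G.codVOp.obj w) (hi : G.dualClass i) :
    IsPullback (P.map (precompVOpHom w i hi)) (α.app (precompVOp w i hi)) (α.app w) (N.map i) := by
  have map_comp_β : P.map (precompVOpHom w i hi) ≫ β.app w = β.app (precompVOp w i hi) :=
    (β.naturality (precompVOpHom w i hi)).trans ((_ ≫= M.map_id _).trans (Category.comp_id _))
  have outer : IsPullback (P.map (precompVOpHom w i hi) ≫ β.app w) (α.app (precompVOp w i hi))
      (f.app (G.domVOp.obj w)) (N.map i ≫ N.map w.obj.hom) :=
    (congrArg₂ (IsPullback · _ _ ·) map_comp_β (N.map_comp _ _).symm).mpr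
      (h.app (precompVOp w i hi))
  exact IsPullback.of_right outer (α.naturality (precompVOpHom w i hi)) (h.app w)

lemma IsSquaresFunctor.isPullback_precompVOpHom_fst [HasPullbacks E] {M N : C ⥤ E}
    [PreservesFiniteLimits N] {f : M ⟶ N} {β : P ⟶ G.domVOp ⋙ M} {α : P ⟶ G.codVOp ⋙ N}
    (h : G.IsSquaresFunctor f β α) (w : G.VOp) {c c' : C} (t : G.codVOp.obj w ⟶ c) {e : c' ⟶ c}
    (he : G.dualClass (pullback.fst t e)) :
    IsPullback (P.map (precompVOpHom w (pullback.fst t e) he))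
      (α.app (precompVOp w (pullback.fst t e) he) ≫ N.map (pullback.snd t e))
      (α.app w ≫ N.map t) (N.map e) :=
  (h.isPullback_precompVOpHom w (pullback.fst t e) he).paste_vert
    ((IsPullback.of_hasPullback t e).map N)

/-- For an arrow classified by `P`, with domain `M`, the transformation exhibiting `P` as the
functor of squares from maps in `V` to that arrow. -/
def classifiedFst {M : C ⥤ E} (i : M ≅ G.idVOp ⋙ P) : P ⟶ G.domVOp ⋙ M :=
  (Functor.whiskerRight G.unitIdVOp P : P ⟶ G.domVOp ⋙ G.idVOp ⋙ P) ≫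
    Functor.whiskerLeft G.domVOp i.inv

lemma classifiedFst_comp {M N : C ⥤ E} (i : M ≅ G.idVOp ⋙ P) (α : P ⟶ G.codVOp ⋙ N)
    {f : M ⟶ N} (hf : ∀ c, f.app c = i.hom.app c ≫ α.app (G.idVOp.obj c)) :
    classifiedFst i ≫ Functor.whiskerLeft G.domVOp f =
      α ≫ Functor.whiskerRight G.codToDom N := by
  ext w
  refine Eq.trans ?_ (α.naturality (G.unitIdVOp.app w))
  refine (Category.assoc _ _ _).trans (_ ≫= ?_)
  exact (_ ≫= hf _).trans (Iso.inv_hom_id_app_assoc i _ _)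

lemma eq_of_classifiedFst_comp_eq {M T : C ⥤ E} (i : M ≅ G.idVOp ⋙ P) {g g' : M ⟶ T}
    (h : classifiedFst i ≫ Functor.whiskerLeft G.domVOp g =
      classifiedFst i ≫ Functor.whiskerLeft G.domVOp g') : g = g' := by
  ext c
  have classifiedFst_app : (classifiedFst i).app (G.idVOp.obj c) = i.inv.app c := by
    have := P.congr_map (G.unitIdVOp_app_idVOp c)
    exact ((this.trans (P.map_id _)) =≫ _).trans (Category.id_comp _)
  have := congr_app h (G.idVOp.obj c)
  simp only [NatTrans.comp_app, classifiedFst_app] at this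
  exact (cancel_epi (i.inv.app c)).1 this

lemma existsUnique_lift_of_isLeftKanExtension {M N Z W : C ⥤ E} (i : M ≅ G.idVOp ⋙ P)
    (α : P ⟶ G.codVOp ⋙ N) [N.IsLeftKanExtension α] {l : M ⟶ N}
    (hl : ∀ c, l.app c = i.hom.app c ≫ α.app (G.idVOp.obj c)) {r : Z ⟶ W}
    (hr : IsPullback (Functor.whiskerLeft G.codVOp r) (Functor.whiskerRight G.codToDom Z)
      (Functor.whiskerRight G.codToDom W) (Functor.whiskerLeft G.domVOp r))
    (a : M ⟶ Z) (b : N ⟶ W) (h : a ≫ r = l ≫ b) : ∃! d : N ⟶ Z, l ≫ d = a ∧ d ≫ r = b := by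
  have fst_iff (d : N ⟶ Z) : (α ≫ Functor.whiskerLeft G.codVOp d) ≫
      Functor.whiskerLeft G.codVOp r = α ≫ Functor.whiskerLeft G.codVOp b ↔ d ≫ r = b := by
    refine ⟨fun e => N.hom_ext_of_isLeftKanExtension α _ _ ?_, fun e => ?_⟩
    · simpa using e
    · simp [← e]
  have α_codToDom {T : C ⥤ E} (d : N ⟶ T) : (α ≫ Functor.whiskerLeft G.codVOp d) ≫
      Functor.whiskerRight G.codToDom T =
        classifiedFst i ≫ Functor.whiskerLeft G.domVOp (l ≫ d) := by
    rw [Functor.whiskerLeft_comp, ← Category.assoc, classifiedFst_comp i α hl]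
    ext w
    simp
  have snd_iff (d : N ⟶ Z) : (α ≫ Functor.whiskerLeft G.codVOp d) ≫
      Functor.whiskerRight G.codToDom Z = classifiedFst i ≫ Functor.whiskerLeft G.domVOp a ↔
        l ≫ d = a := by
    rw [α_codToDom]
    exact ⟨eq_of_classifiedFst_comp_eq i, fun e => by rw [e]⟩
  obtain ⟨δ, hδ, hδ'⟩ := hr.exists_lift (α ≫ Functor.whiskerLeft G.codVOp b)
    (classifiedFst i ≫ Functor.whiskerLeft G.domVOp a) (by
      rw [α_codToDom, ← h, Functor.whiskerLeft_comp, Category.assoc])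
  obtain ⟨d, rfl⟩ : ∃ d : N ⟶ Z, α ≫ Functor.whiskerLeft G.codVOp d = δ :=
    ⟨_, N.descOfIsLeftKanExtension_fac α Z δ⟩
  refine ⟨d, ⟨(snd_iff d).1 hδ', (fst_iff d).1 hδ⟩, fun d' ⟨ha, hb⟩ => ?_⟩
  exact N.hom_ext_of_isLeftKanExtension α _ _ (hr.hom_ext
    (((fst_iff d').2 hb).trans hδ.symm) (((snd_iff d').2 ha).trans hδ'.symm))

end Squares

lemma isPullback_yonedaMap_codVOp (w : G.VOp) :
    IsPullback (yoneda.map (G.unitIdVOp.app w)) (yonedaMap G.codVOp w)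
      (yonedaMap G.codVOp (G.idVOp.obj (G.domVOp.obj w)))
      ((restrictedYoneda G.codVOp).map w.obj.hom) :=
  IsPullback.of_forall_isPullback_app fun a => (Types.isPullback_iff _ _ _ _).2 <| by
    have dom_comp_unit (k : a.unop ⟶ w) : G.domVOp.map (k ≫ G.unitIdVOp.app w) = G.domVOp.map k :=
      Category.comp_id _
    refine ⟨rfl, fun k k' ⟨h₁, h₂⟩ => VOp.hom_ext h₂ ?_, fun k t h => ?_⟩
    · rw [← dom_comp_unit k, ← dom_comp_unit k']
      exact congrArg G.domVOp.map h₁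
    · have hk : t ≫ w.obj.hom = a.unop.obj.hom ≫ k.hom.right :=
        h.symm.trans ((Category.comp_id _).symm.trans k.hom.w)
      exact ⟨ObjectProperty.homMk (Arrow.homMk t k.hom.right hk),
        VOp.hom_ext h.symm (Category.comp_id _), rfl⟩

section Topos

variable {E : Type (u + 1)} [Category.{u} E] [IsGrothendieckTopos E]

lemma epi_sigmaDesc_of_isLeftKanExtension {A D : Type u} [SmallCategory A] [SmallCategory D]
    {F : A ⥤ D} {P : A ⥤ E} {N : D ⥤ E} (α : P ⟶ F ⋙ N) [N.IsLeftKanExtension α] (d : D) :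
    Epi (Sigma.desc fun j : CostructuredArrow F d => α.app j.left ≫ N.map j.hom) := by
  have hN := Functor.isPointwiseLeftKanExtensionOfIsLeftKanExtension N α
  exact (epi_sigmaDesc_iff _).2 fun _ _ _ h => (hN d).hom_ext h

variable {G} {P : G.VOp ⥤ E} [PreservesFiniteLimits P]

lemma isPullback_unit_of_isLeftKanExtension {N : C ⥤ E} (α : P ⟶ G.codVOp ⋙ N)
    [N.IsLeftKanExtension α] (w : G.VOp) :
    IsPullback (P.map (G.unitIdVOp.app w)) (α.app w) (α.app (G.idVOp.obj (G.domVOp.obj w)))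
      (N.map w.obj.hom) := by
  obtain ⟨L, e, i, _, h⟩ := exists_lexExtension_of_isLeftKanExtension α
  exact IsPullback.of_iso ((G.isPullback_yonedaMap_codVOp w).map L) (e.app _) (e.app _)
    (i.app _) (i.app _) (e.hom.naturality _) (h _) (h _) (i.hom.naturality _)

lemma isSquaresFunctor_classifiedFst {M N : C ⥤ E} {f : M ⟶ N} (i : M ≅ G.idVOp ⋙ P)
    (α : P ⟶ G.codVOp ⋙ N) [N.IsLeftKanExtension α]
    (hf : ∀ c, f.app c = i.hom.app c ≫ α.app (G.idVOp.obj c)) :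
    G.IsSquaresFunctor f (classifiedFst i) α :=
  IsPullback.of_forall_isPullback_app fun w => by
    refine IsPullback.of_iso (isPullback_unit_of_isLeftKanExtension α w) (Iso.refl _)
      (i.symm.app _) (Iso.refl _) (Iso.refl _) ?_ ?_ ?_ ?_
    · exact (Category.id_comp _).symm
    · exact (Category.comp_id _).trans (Category.id_comp _).symm
    · refine (Category.comp_id _).trans ((Iso.inv_hom_id_app_assoc i _ _).symm.trans ?_)
      exact i.inv.app _ ≫= (hf _).symm
    · exact (Category.comp_id _).trans (Category.id_comp _).symm

/- Both squares become the pullback `precompVOp w (pullback.fst t e)` over each `P w ⟶ N c`, and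
these maps are jointly epimorphic. -/
lemma IsSquaresFunctor.isPullback_naturality_desc {M N N' : C ⥤ E}
    [PreservesFiniteLimits N'] {f : M ⟶ N'} {β : P ⟶ G.domVOp ⋙ M} {α' : P ⟶ G.codVOp ⋙ N'}
    (h : G.IsSquaresFunctor f β α') (α : P ⟶ G.codVOp ⋙ N) [N.IsLeftKanExtension α] {v : N ⟶ N'}
    (hv : α ≫ Functor.whiskerLeft _ v = α') {c' c : C} {e : c' ⟶ c} (he : G.dualClass e) :
    IsPullback (v.app c') (N.map e) (N'.map e) (v.app c) := by
  have := preservesFiniteLimits_of_isLeftKanExtension α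
  have hα : G.IsSquaresFunctor (N := N) (Functor.whiskerLeft G.idVOp α)
      (classifiedFst (Iso.refl (G.idVOp ⋙ P))) α :=
    isSquaresFunctor_classifiedFst _ α fun _ => (Category.id_comp _).symm
  have he' {w : G.VOp} (t : G.codVOp.obj w ⟶ c) : G.dualClass (pullback.fst t e) :=
    dualClass_of_isPullback (IsPullback.of_hasPullback t e) he
  refine IsGrothendieckTopos.isPullback_of_epi_sigmaDesc (v.naturality e).symm
    (epi_sigmaDesc_of_isLeftKanExtension α c)
    (fun j => (hα.isPullback_precompVOpHom_fst j.left j.hom (he' j.hom)).flip) fun j => ?_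
  have comp_v (w : G.VOp) {d : C} (t : G.codVOp.obj w ⟶ d) :
      (α.app w ≫ N.map t) ≫ v.app d = α'.app w ≫ N'.map t := by
    subst hv
    exact (Category.assoc _ _ _).trans ((_ ≫= v.naturality t).trans (Category.assoc _ _ _).symm)
  exact (congrArg₂ (IsPullback · _ _ ·) (comp_v _ _) (comp_v _ _)).mpr
    (h.isPullback_precompVOpHom_fst j.left j.hom (he' j.hom)).flip

end Topos

section Loc

variable {E : Type (u + 1)} [Category.{u} E]

lemma loc_of_isIso {M N : C ⥤ₗ E} (f : M ⟶ N) [IsIso f] : G.Loc E f := fun _ _ w _ =>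
  IsPullback.of_horiz_isIso ⟨(f.hom.naturality w).symm⟩

variable {G}

lemma Loc.comp {M N K : C ⥤ₗ E} {f : M ⟶ N} {v : N ⟶ K} (hf : G.Loc E f) (hv : G.Loc E v) :
    G.Loc E (f ≫ v) := fun _ _ w hw => (hf w hw).paste_horiz (hv w hw)

lemma Loc.of_comp {M N K : C ⥤ₗ E} {f : M ⟶ N} {v : N ⟶ K} (hv : G.Loc E v)
    (hfv : G.Loc E (f ≫ v)) : G.Loc E f := fun _ _ w hw =>
  IsPullback.of_right (hfv w hw) (f.hom.naturality w).symm (hv w hw)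

lemma Loc.isPullback_whiskerLeft {M N : C ⥤ₗ E} {v : M ⟶ N} (hv : G.Loc E v) :
    IsPullback (Functor.whiskerLeft G.codVOp v.hom) (Functor.whiskerRight G.codToDom M.obj)
      (Functor.whiskerRight G.codToDom N.obj) (Functor.whiskerLeft G.domVOp v.hom) :=
  IsPullback.of_forall_isPullback_app fun w => hv _ w.property

end Loc

section Classifies

variable {G} {E : Type (u + 1)} [Category.{u} E]

lemma Classifies.of_iso {P P' : G.VOp ⥤ₗ E} {M N : C ⥤ₗ E} {f : M ⟶ N} (h : G.Classifies P f)
    (e : P.obj ≅ P'.obj) : G.Classifies P' f := by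
  obtain ⟨i, α, hα, hf⟩ := h
  refine ⟨i ≪≫ Functor.isoWhiskerLeft _ e, e.inv ≫ α,
    (Functor.isLeftKanExtension_iff_of_iso₂ α (e.inv ≫ α) e (Iso.refl _) (by simp)).1 hα,
    fun c => (hf c).trans ?_⟩
  exact (i.hom.app c ≫= (Iso.hom_inv_id_app_assoc e _ _).symm).trans (Category.assoc _ _ _).symm

lemma Classifies.comp_isIso {P : G.VOp ⥤ₗ E} {M N N' : C ⥤ₗ E} {f : M ⟶ N}
    (h : G.Classifies P f) (v : N ⟶ N') [IsIso v] : G.Classifies P (f ≫ v) := by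
  obtain ⟨i, α, hα, hf⟩ := h
  exact ⟨i, α ≫ Functor.whiskerLeft _ v.hom,
    (Functor.isLeftKanExtension_iff_of_iso₂ α _ (Iso.refl _)
      ((leftExactFunctor C E).ι.mapIso (asIso v)) (by simp)).1 hα,
    fun c => (hf c =≫ v.hom.app c).trans (Category.assoc _ _ _)⟩

lemma Classifies.existsUnique_lift {P : G.VOp ⥤ₗ E} {M N Z W : C ⥤ₗ E} {l : M ⟶ N} {r : Z ⟶ W}
    (hl : G.Classifies P l) (hr : G.Loc E r) (a : M ⟶ Z) (b : N ⟶ W) (h : a ≫ r = l ≫ b) :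
    ∃! d : N ⟶ Z, l ≫ d = a ∧ d ≫ r = b := by
  obtain ⟨i, α, hα, hl⟩ := hl
  obtain ⟨d, ⟨hla, hrb⟩, d_unique⟩ := existsUnique_lift_of_isLeftKanExtension i α hl
    hr.isPullback_whiskerLeft a.hom b.hom (congrArg InducedCategory.Hom.hom h)
  refine ⟨ObjectProperty.homMk d, ⟨ObjectProperty.hom_ext _ hla, ObjectProperty.hom_ext _ hrb⟩, ?_⟩
  rintro d' ⟨rfl, rfl⟩
  exact ObjectProperty.hom_ext _ (d_unique _ ⟨rfl, rfl⟩)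

end Classifies

section Factorization

variable {E : Type (u + 1)} [Category.{u} E] [IsGrothendieckTopos E]

variable {G} in
lemma Classifies.exists_isSquaresFunctor {P : G.VOp ⥤ₗ E} {M N : C ⥤ₗ E} {f : M ⟶ N}
    (h : G.Classifies P f) : ∃ (β : P.obj ⟶ G.domVOp ⋙ M.obj) (α : P.obj ⟶ G.codVOp ⋙ N.obj),
      G.IsSquaresFunctor f.hom β α := by
  obtain ⟨i, α, _, hf⟩ := h
  exact ⟨_, α, isSquaresFunctor_classifiedFst i α hf⟩

/-- The object of `Lex[Vᵒᵖ, E]` given by the squares from maps in `V` to `f`. -/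
noncomputable def squaresModel {M N : C ⥤ₗ E} (f : M ⟶ N) : G.VOp ⥤ₗ E :=
  ⟨G.squares f.hom, G.preservesFiniteLimits_squares f.hom⟩

lemma exists_factorization {M N : C ⥤ₗ E} (f : M ⟶ N) :
    ∃ (H : C ⥤ₗ E) (n : M ⟶ H) (v : H ⟶ N),
      G.Classifies (G.squaresModel f) n ∧ G.Loc E v ∧ n ≫ v = f := by
  have := G.preservesFiniteLimits_squares f.hom
  let α := G.codVOp.leftKanExtensionUnit (G.squares f.hom)
  have hα : (G.codVOp.leftKanExtension (G.squares f.hom)).IsLeftKanExtension α := inferInstance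
  let H : C ⥤ₗ E := ⟨G.codVOp.leftKanExtension (G.squares f.hom),
    preservesFiniteLimits_of_isLeftKanExtension α⟩
  let v := H.obj.descOfIsLeftKanExtension α N.obj (G.squaresSnd f.hom)
  have hv : α ≫ Functor.whiskerLeft _ v = G.squaresSnd f.hom :=
    H.obj.descOfIsLeftKanExtension_fac α N.obj (G.squaresSnd f.hom)
  refine ⟨H, ObjectProperty.homMk ((G.domIsoSquares f.hom).hom ≫ Functor.whiskerLeft G.idVOp α),
    ObjectProperty.homMk v, ⟨G.domIsoSquares f.hom, α, hα, fun c => rfl⟩,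
    fun _ _ _ he => (G.isSquaresFunctor_squares f.hom).isPullback_naturality_desc α hv he, ?_⟩
  ext c
  exact (Category.assoc _ _ _).trans ((_ ≫= congr_app hv (G.idVOp.obj c)).trans
    (G.domIsoSquares_hom_comp_squaresSnd f.hom c))

variable (E)

theorem isFactorizationSystem : IsFactorizationSystem (G.Et E) (G.Loc E) :=
  .of_orthogonal (fun _ _ f _ => G.loc_of_isIso f) (fun _ _ _ _ _ => Loc.comp)
    (fun _ _ _ _ v _ ⟨P, h⟩ => ⟨P, h.comp_isIso v⟩)
    (fun _ _ f =>
      let ⟨H, n, v, hn, hv, hf⟩ := G.exists_factorization f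
      ⟨H, n, v, ⟨_, hn⟩, hv, hf⟩)
    (fun _ _ _ _ _ _ a b ⟨_, hl⟩ hr h => hl.existsUnique_lift hr a b h)

variable {E} {G}

lemma classifies_squaresModel {M N H : C ⥤ₗ E} {f : M ⟶ N} {n : M ⟶ H} {v : H ⟶ N}
    (hn : G.Et E n) (hv : G.Loc E v) (hf : n ≫ v = f) : G.Classifies (G.squaresModel f) n := by
  obtain ⟨P, hP⟩ := hn
  obtain ⟨β, α, h⟩ := hP.exists_isSquaresFunctor
  have outer := h.paste_vert hv.isPullback_whiskerLeft.flip
  subst hf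
  exact hP.of_iso (IsPullback.isoIsPullback _ _ outer (G.isSquaresFunctor_squares (n ≫ v).hom))

end Factorization

section ExtensionModel

variable {G}

lemma isExtensionModel_of_loc {E : Type (u + 1)} [Category.{u} E] [IsGrothendieckTopos E]
    {M N : C ⥤ₗ E} {v : M ⟶ N} (hv : G.Loc E v) (hN : IsExtensionModel G.J N) :
    IsExtensionModel G.J M := by
  intro X I Y s hs
  let T : Presieve X := fun Y f => Sieve.ofArrows _ s f ∧ G.V ((presentedModel C).map f.op)
  let K := Σ Y : C, {f : Y ⟶ X // T f}
  have hT : Sieve.ofArrows (fun k : K => k.1) (fun k => k.2.1) ∈ G.J X := by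
    refine G.J.superset_covering ?_ (G.covers_generated _ hs)
    rw [Sieve.generate_le_iff]
    intro Y f hf
    exact Sieve.ofArrows_mk (fun k : K => k.1) (fun k => k.2.1) (⟨Y, f, hf⟩ : K)
  have epi_dual := IsGrothendieckTopos.epi_sigmaDesc_of_isPullback
    (fun k : K => hv k.2.1 k.2.2.2) (hN X K _ _ hT)
  rw [epi_sigmaDesc_iff] at epi_dual ⊢
  refine fun Z a b h => epi_dual a b ?_
  rintro ⟨Y', f, ⟨⟨W, q, _, ⟨i⟩, rfl⟩, -⟩⟩
  simp only [Functor.map_comp, Category.assoc, h]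

end ExtensionModel

section GeometricMorphism

variable {F E : Type (u + 1)} [Category.{u} F] [Category.{u} E] (g : GeometricMorphism F E)

section Loc

variable {G}

lemma Loc.inverseImage {M N : C ⥤ₗ E} {v : M ⟶ N} (hv : G.Loc E v) :
    G.Loc F ((g.inverseImage C).map v) := fun _ _ w hw =>
  have := g.lex
  (hv w hw).map g.inverse

lemma Loc.directImage {M N : C ⥤ₗ F} {v : M ⟶ N} (hv : G.Loc F v) :
    G.Loc E ((g.directImage C).map v) := fun _ _ w hw =>
  have := g.adj.rightAdjoint_preservesLimits
  (hv w hw).map g.direct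

variable (G)

/-- The functor `g^* : Loc[E] ⥤ Loc[F]`. -/
def locInverseImage : G.LocCat E ⥤ G.LocCat F :=
  ObjectProperty.lift _ (G.locIncl E ⋙ (g.inverseImage C).mapArrow)
    (fun v => Loc.inverseImage g v.property)

/-- The functor `g_* : Loc[F] ⥤ Loc[E]`. -/
def locDirectImage : G.LocCat F ⥤ G.LocCat E :=
  ObjectProperty.lift _ (G.locIncl F ⋙ (g.directImage C).mapArrow)
    (fun v => Loc.directImage g v.property)

/-- The inverse image of local arrows is left adjoint to the direct image. -/
noncomputable def locAdj : G.locInverseImage g ⊣ G.locDirectImage g :=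
  (mapArrowAdjunction (g.modelAdj C)).restrictFullyFaithful (ObjectProperty.fullyFaithfulι _)
    (ObjectProperty.fullyFaithfulι _) (Iso.refl _) (Iso.refl _)

end Loc

section Et

variable [IsGrothendieckTopos E] {G}

lemma Classifies.inverseImage {P : G.VOp ⥤ₗ E} {M N : C ⥤ₗ E} {f : M ⟶ N}
    (h : G.Classifies P f) :
    G.Classifies ((g.inverseImage G.VOp).obj P) ((g.inverseImage C).map f) := by
  obtain ⟨i, α, hα, hf⟩ := h
  have := g.adj.leftAdjoint_preservesColimits
  refine ⟨Functor.isoWhiskerRight i g.inverse,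
    Functor.whiskerRight α g.inverse ≫ (Functor.associator _ _ _).hom,
    Functor.PreservesLeftKanExtension.preserves (G := g.inverse) N.obj α, fun c => ?_⟩
  refine (congrArg g.inverse.map (hf c)).trans ((g.inverse.map_comp _ _).trans ?_)
  exact g.inverse.map (i.hom.app c) ≫= (Category.comp_id _).symm

lemma Et.inverseImage {M N : C ⥤ₗ E} {n : M ⟶ N} (hn : G.Et E n) :
    G.Et F ((g.inverseImage C).map n) :=
  let ⟨_, h⟩ := hn
  ⟨_, h.inverseImage g⟩

variable (G)

/-- The functor `g^* : Et[E] ⥤ Et[F]`. -/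
def etInverseImage : G.EtCat E ⥤ G.EtCat F :=
  ObjectProperty.lift _ (G.etIncl E ⋙ (g.inverseImage C).mapArrow)
    (fun n => Et.inverseImage g n.property)

/-- The right adjoint `Et[F] ⥤ Et[E]` of `g^*`, sending an etale arrow `n` to the etale part of
`g_* n`, which need not be etale itself. -/
noncomputable def etDirectImage : G.EtCat F ⥤ G.EtCat E :=
  G.etIncl F ⋙ (g.directImage C).mapArrow ⋙ (G.isFactorizationSystem E).leftArrowFunctor

/-- The inverse image of etale arrows is left adjoint to the etale part of the direct image. -/
noncomputable def etAdj : G.etInverseImage g ⊣ G.etDirectImage g :=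
  ((G.isFactorizationSystem E).leftArrowAdjunction.comp
    (mapArrowAdjunction (g.modelAdj C))).restrictFullyFaithful (Functor.FullyFaithful.id _)
      (ObjectProperty.fullyFaithfulι _) (Iso.refl _) (Iso.refl _)

lemma classifies_etDirectImage [IsGrothendieckTopos F] (n : G.EtCat F) (Q : G.VOp ⥤ₗ F)
    (h : G.Classifies Q n.obj.hom) :
    G.Classifies ((g.directImage G.VOp).obj Q) ((G.etDirectImage g).obj n).obj.hom := by
  have := g.adj.rightAdjoint_preservesLimits
  have fact := G.isFactorizationSystem E
  let f := (g.directImage C).map n.obj.hom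
  obtain ⟨β, α, hβα⟩ := h.exists_isSquaresFunctor
  have direct_squares : G.IsSquaresFunctor f.hom (Functor.whiskerRight β g.direct)
      (Functor.whiskerRight α g.direct) :=
    IsPullback.of_forall_isPullback_app fun w => (hβα.app w).map g.direct
  exact (classifies_squaresModel (fact.leftPart_mem f) (fact.rightPart_mem f)
    (fact.leftPart_rightPart f)).of_iso
      ((G.isSquaresFunctor_squares f.hom).isoIsPullback _ _ direct_squares)

end Et

end GeometricMorphism

end Geometry

theorem mainTheorem8 {C : Type u} [SmallCategory C] [HasFiniteLimits C] (G : Geometry C) :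
    -- `(Et[E], Loc[E])` is a factorization system on `T[E]`
    (∀ (E : Type (u + 1)) [Category.{u} E] [IsGrothendieckTopos E],
      IsFactorizationSystem (G.Et E) (G.Loc E)) ∧
    -- for a geometric morphism `g : F ⟶ E`: stability under `g^*`, and the adjunctions between
    -- `Et[E]` and `Et[F]`, and between `Loc[E]` and `Loc[F]`
    (∀ (F E : Type (u + 1)) [Category.{u} F] [Category.{u} E]
      [IsGrothendieckTopos F] [IsGrothendieckTopos E] (g : GeometricMorphism F E),
      (∀ (M N : C ⥤ₗ E) (n : M ⟶ N), G.Et E n → G.Et F ((g.inverseImage C).map n)) ∧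
      (∀ (M N : C ⥤ₗ E) (v : M ⟶ N), G.Loc E v → G.Loc F ((g.inverseImage C).map v)) ∧
      (∃ (P : G.EtCat E ⥤ G.EtCat F) (R : G.EtCat F ⥤ G.EtCat E),
        Nonempty (P ⋙ G.etIncl F ≅ G.etIncl E ⋙ (g.inverseImage C).mapArrow) ∧
        (∀ (n : G.EtCat F) (Q : G.VOp ⥤ₗ F), G.Classifies Q n.obj.hom →
          G.Classifies ((g.directImage G.VOp).obj Q) (R.obj n).obj.hom) ∧
        Nonempty (P ⊣ R)) ∧
      (∃ (P : G.LocCat E ⥤ G.LocCat F) (R : G.LocCat F ⥤ G.LocCat E),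
        Nonempty (P ⋙ G.locIncl F ≅ G.locIncl E ⋙ (g.inverseImage C).mapArrow) ∧
        Nonempty (R ⋙ G.locIncl E ≅ G.locIncl F ⋙ (g.directImage C).mapArrow) ∧
        Nonempty (P ⊣ R))) ∧
    -- models of `T_J` are closed backwards along local arrows
    (∀ (E : Type (u + 1)) [Category.{u} E] [IsGrothendieckTopos E] (M N : C ⥤ₗ E) (v : M ⟶ N),
      G.Loc E v → IsExtensionModel G.J N → IsExtensionModel G.J M) ∧
    -- the middle object of the factorization of an arrow towards a model of `T_J` is a model
    -- of `T_J`
    (∀ (E : Type (u + 1)) [Category.{u} E] [IsGrothendieckTopos E] (M N : C ⥤ₗ E) (f : M ⟶ N),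
      IsExtensionModel G.J N →
      ∀ (H : C ⥤ₗ E) (n : M ⟶ H) (v : H ⟶ N), G.Et E n → G.Loc E v → n ≫ v = f →
        IsExtensionModel G.J H) ∧
    -- the geometry induces an admissibility structure
    IsAdmissibilityStructure G.J (fun E _ _ => G.Loc E) := by
  refine ⟨fun E _ _ => G.isFactorizationSystem E,
    fun F E _ _ _ _ g => ⟨fun _ _ _ h => h.inverseImage g, fun _ _ _ h => h.inverseImage g,
      ⟨G.etInverseImage g, G.etDirectImage g, ⟨Iso.refl _⟩, G.classifies_etDirectImage g,
        ⟨G.etAdj g⟩⟩,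
      ⟨G.locInverseImage g, G.locDirectImage g, ⟨Iso.refl _⟩, ⟨Iso.refl _⟩, ⟨G.locAdj g⟩⟩⟩,
    fun _ _ _ _ _ _ hv => Geometry.isExtensionModel_of_loc hv,
    fun _ _ _ _ _ _ hN _ _ _ _ hv _ => Geometry.isExtensionModel_of_loc hv hN,
    { inverse_image := fun _ _ _ _ _ _ g _ _ _ hv => hv.inverseImage g
      iso := fun _ _ _ _ _ v _ => G.loc_of_isIso v
      left_cancel := fun _ _ _ _ _ _ _ _ => Geometry.Loc.of_comp
      factorization := fun E _ _ M N f hN => ?_ }⟩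
  obtain ⟨H, n, v, hn, hv, hf⟩ := G.exists_factorization f
  exact ⟨H, n, v, hv, Geometry.isExtensionModel_of_loc hv hN, hf, fun K a w hw haw =>
    hn.existsUnique_lift hw a v (haw.trans hf.symm)⟩
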